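/- Let $F=\mathrm{GF}(q)$ and $r\le n-r$. For $\mathbf C\in F^{r\times(n-r)}$ let $I(\mathbf C)\subseteq F^n$ be its lifting, i.e. the row space of $(\mathbf I_r\mid\mathbf C)$; for subspaces let $d_S(U,V)=\dim(U+V)-\dim(U\cap V)$. An operator channel takes a subspace of $F^n$ to a random subspace of $F^n$; it is symmetric if all outputs with the same dimension and at the same distance $d_S$ from the input are equiprobable. The bounded subspace distance decoder of radius $t$ of a set of subspaces (the code) outputs a codeword at distance $d_S\le t$ from the received subspace if there is one, and fails otherwise; a decoder error occurs if it outputs a codeword other than the sent one. Let $P_S(I(\mathbf C),u,v,t)$ be the probability of a decoder error when $I(\mathbf C)$ is sent over a symmetric operator channel, conditional on the received subspace having dimension $v$ and being at distance $d_S=u$ from $I(\mathbf C)$ (the probability is understood to be $0$ if this condition has probability $0$). Let $\mathcal C\subseteq F^{r\times(n-r)}$ be any code whose minimum rank distance (the minimum of $\mathrm{rk}(\mathbf X-\mathbf Y)$ over distinct codewords) is $d$, and let $\mathbf C\in\mathcal C$. Let $\mathcal M\subseteq F^{r\times(n-r)}$ be any MRD code with minimum rank distance $d$, i.e. one of maximum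 cardinality among the codes with minimum rank distance $d$, let $\mathbf M\in\mathcal M$, and write $P_{S,KK}(u,v,d-1)=P_S(I(\mathbf M),u,v,d-1)$ for the decoder error probability of its lifting (a KK code). Suppose that $q>2$, or $r<n-r$, or $d\ne n-r-1$. Then, for all $u,v$ with $u\ge d+1$ and $|v-r|\le d-1$ for which the conditions on the received subspaces have positive probability, $$P_S(I(\mathbf C),u,v,d-1)<H_q\,P_{S,KK}(u,v,d-1),\qquad H_2=3.5,\quad H_q=\frac{q-1}{q-2}\ \text{ for } q>2.$$ For all $u,v$ with $u\le d$ or $|v-r|\ge d$, both probabilities are $0$. -/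

import Mathlib

/-- The rank distance between two matrices. -/
noncomputable def rankDist {F : Type*} [Field F] {a b : ℕ}
    (X Y : Matrix (Fin a) (Fin b) F) : ℕ :=
  (X - Y).rank

/-- `d` is the minimum rank distance of the code `C`, the minimum being taken over all pairs of
distinct codewords. -/
def HasMinRankDist {F : Type*} [Field F] {a b : ℕ}
    (C : Set (Matrix (Fin a) (Fin b) F)) (d : ℕ) : Prop :=
  IsLeast {k : ℕ | ∃ X ∈ C, ∃ Y ∈ C, X ≠ Y ∧ rankDist X Y = k} d

/-- `C` is a maximum rank distance code with minimum rank distance `d`: it has the maximum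
cardinality among all codes of the same format with minimum rank distance `d`. -/
def IsMRD {F : Type*} [Field F] {a b : ℕ}
    (C : Set (Matrix (Fin a) (Fin b) F)) (d : ℕ) : Prop :=
  HasMinRankDist C d ∧
    ∀ C' : Set (Matrix (Fin a) (Fin b) F), HasMinRankDist C' d → C'.ncard ≤ C.ncard

/-- The row space of a matrix. -/
def rowSpace {F : Type*} [Field F] {ι κ : Type*} (A : Matrix ι κ F) : Submodule F (κ → F) :=
  Submodule.span F (Set.range A.row)

/-- The lifting `I(C) = R(I_a | C)` of a matrix, a subspace of `F ^ (a + b)`. -/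
def lifting {F : Type*} [Field F] {a b : ℕ} (C : Matrix (Fin a) (Fin b) F) :
    Submodule F (Fin a ⊕ Fin b → F) :=
  rowSpace (Matrix.fromCols (1 : Matrix (Fin a) (Fin a) F) C)

/-- The subspace distance `dim (U + V) - dim (U ∩ V)`. -/
noncomputable def subspaceDist {F : Type*} [Field F] {κ : Type*}
    (U V : Submodule F (κ → F)) : ℕ :=
  Module.finrank F (U ⊔ V : Submodule F (κ → F)) - Module.finrank F (U ⊓ V : Submodule F (κ → F))

/-- An operator channel: each input subspace gives a probability distribution on output
subspaces. -/
abbrev OperatorChannel (F : Type*) [Field F] (κ : Type*) :=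
  Submodule F (κ → F) → PMF (Submodule F (κ → F))

/-- An operator channel is symmetric when all outputs with the same dimension and at the same
subspace distance from the input are equiprobable. -/
def OperatorChannel.IsSymmetric {F : Type*} [Field F] {κ : Type*}
    (W : OperatorChannel F κ) : Prop :=
  ∀ U V V' : Submodule F (κ → F), Module.finrank F V = Module.finrank F V' →
    subspaceDist U V = subspaceDist U V' → W U V = W U V'

open Classical in
/-- The bounded subspace distance decoder with radius `t` of the code `𝒞`: it returns a codeword
at subspace distance at most `t` from the received subspace if there is one, and declares a
failure (`none`) otherwise. -/
noncomputable def boundedDistanceDecoder {F : Type*} [Field F] {κ : Type*}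
    (𝒞 : Set (Submodule F (κ → F))) (t : ℕ) (V : Submodule F (κ → F)) :
    Option (Submodule F (κ → F)) :=
  if h : ∃ D ∈ 𝒞, subspaceDist V D ≤ t then some h.choose else none

/-- The received subspaces of dimension `v` at subspace distance `u` from the sent subspace `U`. -/
def receivedEvent {F : Type*} [Field F] {κ : Type*}
    (U : Submodule F (κ → F)) (u v : ℕ) : Set (Submodule F (κ → F)) :=
  {V | Module.finrank F V = v ∧ subspaceDist U V = u}

/-- The received subspaces for which a decoder error occurs when `U` is sent: the decoder
produces a codeword other than `U`. -/
def decoderErrorEvent {F : Type*} [Field F] {κ : Type*}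
    (𝒞 : Set (Submodule F (κ → F))) (t : ℕ) (U : Submodule F (κ → F)) :
    Set (Submodule F (κ → F)) :=
  {V | ∃ D, boundedDistanceDecoder 𝒞 t V = some D ∧ D ≠ U}

/-- The decoder error probability of the bounded subspace distance decoder with radius `t` of the
code `𝒞` over the channel `W`, when `U` is sent, conditional on the received subspace having
dimension `v` and being at subspace distance `u` from `U`. -/
noncomputable def decoderErrorProb {F : Type*} [Field F] {κ : Type*}
    (W : OperatorChannel F κ) (𝒞 : Set (Submodule F (κ → F))) (U : Submodule F (κ → F))
    (u v t : ℕ) : ℝ :=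
  ((W U).toOuterMeasure (receivedEvent U u v ∩ decoderErrorEvent 𝒞 t U) /
    (W U).toOuterMeasure (receivedEvent U u v)).toReal

/-- The scalar `H_q`: `H_2 = 3.5` and `H_q = (q - 1) / (q - 2)` for `q > 2`. -/
noncomputable def scalarH (q : ℕ) : ℝ :=
  if q = 2 then 7 / 2 else ((q : ℝ) - 1) / ((q : ℝ) - 2)

/-! Over a symmetric channel the conditional error probability is a ratio of counts
(`OperatorChannel.IsSymmetric.decoderErrorProb_eq`), and its denominator depends only on `u`, `v`
and the dimension of the sent subspace. For `u ≥ d + 1` the numerator is a sum over the other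
codewords `D` of the number of received subspaces within `d - 1` of `lifting D`; these sets are
disjoint by the triangle inequality (`RankSeparated.ncard_error`). Pairs of subspaces are classified
up to linear equivalence by dimensions, so each term is `ψ` of the dimension of the intersection of
the two liftings, which is that of the left kernel of `D - X`.

Grouping codewords by this left kernel `K` (`RankSeparated.sum_nearEvent`) reduces the claim to one
comparison for each `K`: the number of `D` with `leftKer (D - X) = K` in an arbitrary code against
the corresponding number in an MRD code (`RankSeparated.card_filter_leftKer_lt`).

Write `Q = q ^ b` and let `w` be the codimension of `K`. In any code, such a `D` is determined by
the independent images of `w - d + 1` vectors, which bounds the count by a product of factors `Q - q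
^ i`. An MRD code attains the Singleton bound, because Gabidulin codes do; hence the number of
codewords agreeing with `Y` on a subspace depends only on its dimension, as long as that is at most
`a + 1 - d`. Inclusion-exclusion over subspaces, truncated after an odd term, then bounds the MRD
count from below.

Strictness of the final sum needs one `K` with `ψ (finrank F K) > 0`, supplied by
`exists_subspace_near`. -/

/-- The left kernel of a matrix: the row vectors which it annihilates. -/
def leftKer {F : Type*} [Field F] {a b : ℕ} (Z : Matrix (Fin a) (Fin b) F) :
    Submodule F (Fin a → F) :=
  LinearMap.ker Z.vecMulLinear

/-- Distinct codewords are at rank distance at least `d`. -/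
def RankSeparated {F : Type*} [Field F] {a b : ℕ}
    (C : Finset (Matrix (Fin a) (Fin b) F)) (d : ℕ) : Prop :=
  ∀ X ∈ C, ∀ Y ∈ C, X ≠ Y → d ≤ (X - Y).rank

/-! ### Dimensions of subspaces and counts of independent tuples -/

section Subspaces

variable {F V : Type*} [Field F] [AddCommGroup V] [Module F V] [FiniteDimensional F V]

theorem exists_between_finrank_eq {A B : Submodule F V} (hAB : A ≤ B) {k : ℕ}
    (hA : Module.finrank F A ≤ k) (hB : k ≤ Module.finrank F B) :
    ∃ C, A ≤ C ∧ C ≤ B ∧ Module.finrank F C = k := by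
  induction k, hA using Nat.le_induction with
  | base => exact ⟨A, le_rfl, hAB, rfl⟩
  | succ k hk ih =>
    obtain ⟨C, hAC, hCB, hC⟩ := ih (by omega)
    have hne : C ≠ B := by rintro rfl; omega
    obtain ⟨x, hxB, hxC⟩ := SetLike.exists_of_lt (lt_of_le_of_ne hCB hne)
    refine ⟨C ⊔ Submodule.span F {x}, hAC.trans le_sup_left,
      sup_le hCB ((Submodule.span_singleton_le_iff_mem _ _).2 hxB), ?_⟩
    have hx0 : x ≠ 0 := by rintro rfl; exact hxC C.zero_mem
    have hdisj : Disjoint C (Submodule.span F {x}) :=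
      (Submodule.disjoint_span_singleton' hx0).2 hxC
    have h1 := Submodule.finrank_sup_add_finrank_inf_eq C (Submodule.span F {x})
    rw [hdisj.eq_bot, finrank_bot, finrank_span_singleton hx0] at h1
    omega

theorem finrank_sup_of_disjoint {A B : Submodule F V} (h : Disjoint A B) :
    Module.finrank F (A ⊔ B : Submodule F V) = Module.finrank F A + Module.finrank F B := by
  have h1 := Submodule.finrank_sup_add_finrank_inf_eq A B
  rwa [h.eq_bot, finrank_bot, add_zero] at h1

theorem natCard_linearIndependent_mem [Fintype F] (N : Submodule F V) (j : ℕ) :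
    Nat.card {s : Fin j → V // LinearIndependent F s ∧ ∀ i, s i ∈ N} =
      ∏ i ∈ Finset.range j, (Fintype.card F ^ Module.finrank F N - Fintype.card F ^ i) := by
  have e : {s : Fin j → V // LinearIndependent F s ∧ ∀ i, s i ∈ N} ≃
      {s : Fin j → N // LinearIndependent F s} :=
    { toFun := fun s => ⟨fun i => ⟨s.1 i, s.2.2 i⟩,
        LinearIndependent.of_comp N.subtype (by exact s.2.1)⟩
      invFun := fun s => ⟨fun i => (s.1 i : V),
        by exact s.2.map' N.subtype N.ker_subtype, fun i => (s.1 i).2⟩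
      left_inv := fun s => rfl
      right_inv := fun s => rfl }
  have : Finite N := Module.finite_of_finite F
  rw [Nat.card_congr e]
  rcases le_or_gt j (Module.finrank F N) with h | h
  · rw [card_linearIndependent h, Finset.prod_range]
  -- With more vectors than dimensions, the factor with `i = finrank F N` vanishes, matching the
  -- absence of independent tuples.
  · rw [Finset.prod_eq_zero (Finset.mem_range.2 h) (by simp)]
    rw [Nat.card_eq_zero]
    left
    refine ⟨fun s => ?_⟩
    have := s.2.fintype_card_le_finrank
    simp at this
    omega

end Subspaces

/-! ### Left kernels of differences of codewords -/

section Counting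

variable {F : Type*} [Field F] {a b : ℕ}

theorem mem_leftKer {Z : Matrix (Fin a) (Fin b) F} {x : Fin a → F} :
    x ∈ leftKer Z ↔ Matrix.vecMul x Z = 0 := Iff.rfl

theorem mem_leftKer_sub {X Y : Matrix (Fin a) (Fin b) F} {x : Fin a → F} :
    x ∈ leftKer (X - Y) ↔ Matrix.vecMul x X = Matrix.vecMul x Y := by
  rw [mem_leftKer, Matrix.vecMul_sub, sub_eq_zero]

theorem rank_add_finrank_leftKer (Z : Matrix (Fin a) (Fin b) F) :
    Z.rank + Module.finrank F (leftKer Z) = a := by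
  have h := LinearMap.finrank_range_add_finrank_ker Z.vecMulLinear
  rw [Module.finrank_fin_fun] at h
  rw [leftKer, ← Matrix.rank_transpose, Matrix.rank, Matrix.mulVecLin_transpose, h]

theorem leftKer_sub_inf_le (X Y Z : Matrix (Fin a) (Fin b) F) :
    leftKer (X - Z) ⊓ leftKer (Y - Z) ≤ leftKer (X - Y) := by
  rintro x ⟨h1, h2⟩
  exact mem_leftKer_sub.2 ((mem_leftKer_sub.1 h1).trans (mem_leftKer_sub.1 h2).symm)

/-- By rank-nullity, a left kernel of dimension above `a - d` means rank below `d`. This is the only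
way in which the minimum distance enters the upper bounds on codeword counts. -/
theorem RankSeparated.eq_of_le_leftKer {C : Finset (Matrix (Fin a) (Fin b) F)} {d : ℕ}
    (hC : RankSeparated C d) {X Y : Matrix (Fin a) (Fin b) F} (hX : X ∈ C) (hY : Y ∈ C)
    {L : Submodule F (Fin a → F)} (hL : L ≤ leftKer (X - Y)) (hd : a < Module.finrank F L + d) :
    X = Y := by
  by_contra hne
  have h1 := hC X hX Y hY hne
  have h2 := rank_add_finrank_leftKer (X - Y)
  have h3 := Submodule.finrank_mono hL
  omega

theorem HasMinRankDist.rankSeparated {a b d : ℕ} {C : Finset (Matrix (Fin a) (Fin b) F)}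
    (hC : HasMinRankDist (C : Set (Matrix (Fin a) (Fin b) F)) d) : RankSeparated C d :=
  fun X hX Y hY hne => hC.2 ⟨X, hX, Y, hY, hne, rfl⟩

theorem HasMinRankDist.one_le_and_le {a b d : ℕ} {C : Set (Matrix (Fin a) (Fin b) F)}
    (hC : HasMinRankDist C d) : 1 ≤ d ∧ d ≤ a := by
  obtain ⟨X, -, Y, -, hne, h⟩ := hC.1
  rw [rankDist] at h
  have h1 := rank_add_finrank_leftKer (X - Y)
  refine ⟨Nat.one_le_iff_ne_zero.2 ?_, by omega⟩
  rintro rfl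
  apply hne
  have h2 : leftKer (X - Y) = ⊤ := Submodule.eq_top_of_finrank_eq (by
    rw [Module.finrank_fin_fun]; omega)
  ext1 i j
  have h3 : Pi.single i 1 ∈ leftKer (X - Y) := h2 ▸ Submodule.mem_top
  rw [mem_leftKer_sub, Matrix.single_one_vecMul, Matrix.single_one_vecMul] at h3
  exact congrFun h3 j

theorem leftKer_eq_iff_finrank_inf_eq_zero {Z : Matrix (Fin a) (Fin b) F}
    {K K' : Submodule F (Fin a → F)} (hK : IsCompl K K') (hZ : K ≤ leftKer Z) :
    Module.finrank F (leftKer Z ⊓ K' : Submodule F (Fin a → F)) = 0 ↔ leftKer Z = K := by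
  rw [Submodule.finrank_eq_zero]
  constructor
  · intro h
    exact (eq_of_le_of_inf_le_of_le_sup hZ (by rw [h]; exact bot_le)
      (by rw [hK.sup_eq_top]; exact le_top)).symm
  · rintro h
    rw [h, hK.inf_eq_bot]

variable [Fintype F]

open Classical in
/-- The number of codewords whose difference with a given codeword has a given left kernel. -/
theorem RankSeparated.card_filter_leftKer_eq_le {C : Finset (Matrix (Fin a) (Fin b) F)} {d w : ℕ}
    (hC : RankSeparated C d) (hd : 1 ≤ d) (hdw : d ≤ w) (X : Matrix (Fin a) (Fin b) F)
    {K : Submodule F (Fin a → F)} (hK : Module.finrank F K + w = a) :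
    (C.filter fun D => leftKer (D - X) = K).card ≤
      ∏ i ∈ Finset.range (w - d + 1), (Fintype.card F ^ b - Fintype.card F ^ i) := by
  obtain ⟨K', hK'⟩ := Submodule.exists_isCompl K
  have hdim : Module.finrank F K' = w := by
    have h := Submodule.finrank_add_eq_of_isCompl hK'
    rw [Module.finrank_fin_fun] at h
    omega
  -- The dimension `w - d + 1` is the least for which `K ⊔ L` has dimension above `a - d`, so that
  -- agreement on it forces equality. Since `L` misses `K`, `D - X` is injective on `L` and sends a
  -- basis to an independent tuple.
  obtain ⟨L, -, hLK', hL⟩ := exists_between_finrank_eq (bot_le : ⊥ ≤ K') (k := w - d + 1)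
    (by simp) (by omega)
  let β := Module.finBasisOfFinrankEq F L hL
  have hcard := natCard_linearIndependent_mem (⊤ : Submodule F (Fin b → F)) (w - d + 1)
  rw [finrank_top, Module.finrank_fin_fun] at hcard
  rw [← hcard, ← Nat.card_eq_finsetCard]
  have hLK : Disjoint K L := hK'.disjoint.mono_right hLK'
  refine Nat.card_le_card_of_injective (fun D => ⟨fun i => Matrix.vecMul (β i : Fin a → F)
    (D.1 - X), ?_, fun i => trivial⟩) ?_
  · have hD := (Finset.mem_filter.1 D.2).2
    have h1 : LinearIndependent F (fun i => (β i : Fin a → F)) :=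
      β.linearIndependent.map' L.subtype L.ker_subtype
    refine h1.map (f := (D.1 - X).vecMulLinear) ?_
    have hspan : Submodule.span F (Set.range fun i => (β i : Fin a → F)) ≤ L :=
      Submodule.span_le.2 (by rintro _ ⟨i, rfl⟩; exact (β i).2)
    have : LinearMap.ker (D.1 - X).vecMulLinear = K := hD
    rw [this]
    exact (hLK.mono_right hspan).symm
  · intro D D' h
    have hD := Finset.mem_filter.1 D.2
    have hD' := Finset.mem_filter.1 D'.2
    apply Subtype.ext
    refine hC.eq_of_le_leftKer hD.1 hD'.1 (L := K ⊔ L) (sup_le ?_ ?_) ?_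
    · exact le_trans (le_inf hD.2.ge hD'.2.ge) (leftKer_sub_inf_le _ _ _)
    · have h2 : (D.1 - D'.1).vecMulLinear ∘ₗ L.subtype = 0 := by
        refine β.ext fun i => ?_
        have h3 := congrFun (congrArg Subtype.val h) i
        simp only [Matrix.vecMul_sub] at h3
        simp only [LinearMap.comp_apply, Submodule.subtype_apply, Matrix.vecMulLinear_apply,
          Matrix.vecMul_sub, LinearMap.zero_apply]
        rw [sub_eq_zero]
        exact sub_left_injective h3
      intro x hx
      exact LinearMap.congr_fun h2 ⟨x, hx⟩
    · rw [finrank_sup_of_disjoint hLK]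
      omega

/-- Adding `c` independent dimensions to `L` gives a subspace large enough to determine a codeword,
so restriction to those dimensions is injective on `S`. -/
theorem RankSeparated.card_le_of_agree {C : Finset (Matrix (Fin a) (Fin b) F)} {d : ℕ}
    (hC : RankSeparated C d) {L : Submodule F (Fin a → F)} {c : ℕ}
    (hL : Module.finrank F L + c + d = a + 1) (hd : 1 ≤ d)
    {S : Finset (Matrix (Fin a) (Fin b) F)} (hSC : S ⊆ C)
    (hS : ∀ X ∈ S, ∀ Y ∈ S, L ≤ leftKer (X - Y)) :
    S.card ≤ Fintype.card F ^ (b * c) := by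
  obtain ⟨L', hL'⟩ := Submodule.exists_isCompl L
  have hdim := Submodule.finrank_add_eq_of_isCompl hL'
  rw [Module.finrank_fin_fun] at hdim
  obtain ⟨W, -, hWL', hW⟩ := exists_between_finrank_eq (bot_le : ⊥ ≤ L') (k := c)
    (by simp) (by omega)
  have hLW : Disjoint L W := hL'.disjoint.mono_right hWL'
  have hcard : Nat.card (W →ₗ[F] (Fin b → F)) = Fintype.card F ^ (b * c) := by
    rw [Module.natCard_eq_pow_finrank (K := F), Module.finrank_linearMap, hW,
      Module.finrank_fin_fun, Nat.card_eq_fintype_card, mul_comm]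
  have : Finite (W →ₗ[F] (Fin b → F)) := Module.finite_of_finite F
  rw [← hcard, ← Nat.card_eq_finsetCard]
  refine Nat.card_le_card_of_injective (fun D => D.1.vecMulLinear.domRestrict W) ?_
  intro D D' h
  apply Subtype.ext
  refine hC.eq_of_le_leftKer (hSC D.2) (hSC D'.2) (L := L ⊔ W) (sup_le (hS _ D.2 _ D'.2) ?_) ?_
  · intro x hx
    exact mem_leftKer_sub.2 (LinearMap.congr_fun h ⟨x, hx⟩)
  · rw [finrank_sup_of_disjoint hLW]
    omega

/-- The Singleton bound. -/
theorem RankSeparated.card_le {C : Finset (Matrix (Fin a) (Fin b) F)} {d c : ℕ}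
    (hC : RankSeparated C d) (hc : c + d = a + 1) (hd : 1 ≤ d) :
    C.card ≤ Fintype.card F ^ (b * c) :=
  hC.card_le_of_agree (L := ⊥) (by simpa using hc) hd subset_rfl (fun _ _ _ _ => bot_le)

open Classical in
/-- In a code attaining the Singleton bound, the number of codewords which agree with a given matrix
on a given subspace. -/
theorem RankSeparated.card_filter_le_leftKer {M : Finset (Matrix (Fin a) (Fin b) F)} {d k : ℕ}
    (hM : RankSeparated M d) (hk : k + d = a + 1) (hd : 1 ≤ d)
    (hcard : M.card = Fintype.card F ^ (b * k)) (Y : Matrix (Fin a) (Fin b) F)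
    {L : Submodule F (Fin a → F)} {c : ℕ} (hL : Module.finrank F L + c = k) :
    (M.filter fun D => L ≤ leftKer (D - Y)).card = Fintype.card F ^ (b * c) := by
  have : Finite (L →ₗ[F] (Fin b → F)) := Module.finite_of_finite F
  let _ : Fintype (L →ₗ[F] (Fin b → F)) := Fintype.ofFinite _
  have hhom : Fintype.card (L →ₗ[F] (Fin b → F)) = Fintype.card F ^ (b * Module.finrank F L) := by
    rw [← Nat.card_eq_fintype_card, Module.natCard_eq_pow_finrank (K := F),
      Module.finrank_linearMap, Module.finrank_fin_fun, Nat.card_eq_fintype_card, mul_comm]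
  let ρ : Matrix (Fin a) (Fin b) F → (L →ₗ[F] (Fin b → F)) :=
    fun D => D.vecMulLinear.domRestrict L
  have hρ : ∀ D D', ρ D = ρ D' ↔ L ≤ leftKer (D - D') := by
    intro D D'
    constructor
    · intro h x hx
      exact mem_leftKer_sub.2 (LinearMap.congr_fun h ⟨x, hx⟩)
    · intro h
      ext1 x
      exact mem_leftKer_sub.1 (h x.2)
  have hle : ∀ h : L →ₗ[F] (Fin b → F),
      (M.filter fun D => ρ D = h).card ≤ Fintype.card F ^ (b * c) := by
    intro h
    refine hM.card_le_of_agree (L := L) (by omega) hd (Finset.filter_subset _ _) ?_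
    intro X hX Z hZ
    rw [← hρ, (Finset.mem_filter.1 hX).2, (Finset.mem_filter.1 hZ).2]
  have hsum := Finset.card_eq_sum_card_fiberwise (s := M) (t := Finset.univ) (f := ρ)
    (fun _ _ => Finset.mem_coe.2 (Finset.mem_univ _))
  -- There are `q ^ (b * finrank F L)` restrictions, each with at most `q ^ (b * c)` codewords, and
  -- the total `q ^ (b * k)` is the product; so every fibre is full.
  have hall : ∀ h ∈ (Finset.univ : Finset (L →ₗ[F] (Fin b → F))),
      (M.filter fun D => ρ D = h).card = Fintype.card F ^ (b * c) := by
    refine (Finset.sum_eq_sum_iff_of_le (fun h _ => hle h)).1 ?_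
    rw [← hsum, Finset.sum_const, Finset.card_univ, hhom, smul_eq_mul, ← pow_add, ← mul_add, hL,
      hcard]
  rw [← hall (ρ Y) (Finset.mem_univ _)]
  simp only [hρ]

open Classical in
/-- Double counting of the linearly independent tuples of row vectors, in a complement of `K`,
which are annihilated by differences of codewords. -/
theorem RankSeparated.sum_prod_leftKer_inf {M : Finset (Matrix (Fin a) (Fin b) F)} {d k : ℕ}
    (hM : RankSeparated M d) (hk : k + d = a + 1) (hd : 1 ≤ d)
    (hcard : M.card = Fintype.card F ^ (b * k)) {Y : Matrix (Fin a) (Fin b) F} (hY : Y ∈ M)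
    {K K' : Submodule F (Fin a → F)} (hK : IsCompl K K') {j c : ℕ}
    (hj : Module.finrank F K + j + c = k) :
    ∑ D ∈ M.filter (fun D => K ≤ leftKer (D - Y) ∧ D ≠ Y),
      ∏ i ∈ Finset.range j, (Fintype.card F ^ Module.finrank F (leftKer (D - Y) ⊓ K' :
        Submodule F (Fin a → F)) - Fintype.card F ^ i) =
    (∏ i ∈ Finset.range j, (Fintype.card F ^ Module.finrank F K' - Fintype.card F ^ i)) *
      (Fintype.card F ^ (b * c) - 1) := by
  let T : Finset (Fin j → Fin a → F) :=
    Finset.univ.filter fun s => LinearIndependent F s ∧ ∀ i, s i ∈ K'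
  have hN : ∀ N : Submodule F (Fin a → F),
      (Finset.univ.filter fun s : Fin j → Fin a → F => LinearIndependent F s ∧ ∀ i, s i ∈ N).card =
      ∏ i ∈ Finset.range j, (Fintype.card F ^ Module.finrank F N - Fintype.card F ^ i) := by
    intro N
    rw [← natCard_linearIndependent_mem N j, Nat.card_eq_fintype_card, Fintype.card_subtype]
  have hdc := Finset.sum_card_bipartiteAbove_eq_sum_card_bipartiteBelow
    (s := M.filter (fun D => K ≤ leftKer (D - Y) ∧ D ≠ Y)) (t := T)
    (fun D s => ∀ i, s i ∈ leftKer (D - Y))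
  rw [← hN K']
  calc _ = ∑ D ∈ M.filter (fun D => K ≤ leftKer (D - Y) ∧ D ≠ Y),
        (T.bipartiteAbove (fun D s => ∀ i, s i ∈ leftKer (D - Y)) D).card := by
        refine Finset.sum_congr rfl fun D _ => ?_
        rw [← hN, Finset.bipartiteAbove, Finset.filter_filter]
        congr 1
        ext s
        simp only [Finset.mem_filter, Finset.mem_univ, true_and, Submodule.mem_inf]
        grind
    _ = _ := hdc
    _ = ∑ s ∈ T, (Fintype.card F ^ (b * c) - 1) := by
        refine Finset.sum_congr rfl fun s hs => ?_
        obtain ⟨-, hs1, hs2⟩ := Finset.mem_filter.1 hs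
        have hspan : Submodule.span F (Set.range s) ≤ K' :=
          Submodule.span_le.2 (by rintro _ ⟨i, rfl⟩; exact hs2 i)
        have hdim : Module.finrank F (K ⊔ Submodule.span F (Set.range s) :
            Submodule F (Fin a → F)) + c = k := by
          rw [finrank_sup_of_disjoint (hK.disjoint.mono_right hspan), finrank_span_eq_card hs1,
            Fintype.card_fin]
          exact hj
        have h1 := hM.card_filter_le_leftKer hk hd hcard Y hdim
        rw [← h1, Finset.bipartiteBelow, Finset.filter_filter]
        -- `Y` agrees with itself but is excluded from the sum; hence the `- 1`.
        rw [← Finset.card_erase_of_mem (a := Y)]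
        · congr 1
          ext D
          simp only [Finset.mem_filter, Finset.mem_erase, sup_le_iff, Submodule.span_le,
            Set.range_subset_iff, SetLike.mem_coe]
          grind
        · rw [Finset.mem_filter, sub_self]
          refine ⟨hY, fun x _ => ?_⟩
          rw [mem_leftKer, Matrix.vecMul_zero]
    _ = _ := by rw [Finset.sum_const, smul_eq_mul]

end Counting

/-! ### Truncated inclusion-exclusion over subspaces -/

section Numerics

theorem cast_prod_pow_sub_pow {q : ℕ} (hq : 1 ≤ q) (c j : ℕ) :
    ((∏ i ∈ Finset.range j, (q ^ c - q ^ i) : ℕ) : ℝ) =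
      ∏ i ∈ Finset.range j, ((q : ℝ) ^ c - (q : ℝ) ^ i) := by
  rcases le_or_gt j c with h | h
  · rw [Nat.cast_prod]
    refine Finset.prod_congr rfl fun i hi => ?_
    have : q ^ i ≤ q ^ c := Nat.pow_le_pow_right hq (by have := Finset.mem_range.1 hi; omega)
    push_cast [Nat.cast_sub this]
    rfl
  · rw [Finset.prod_eq_zero (Finset.mem_range.2 h) (by simp),
      Finset.prod_eq_zero (Finset.mem_range.2 h) (by simp), Nat.cast_zero]

theorem prod_pow_sub_pow_le (q Q l : ℕ) :
    ∏ i ∈ Finset.range (l + 1), (Q - q ^ i) ≤ Q ^ l * (Q - 1) := by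
  rw [Finset.prod_range_succ', pow_zero]
  refine Nat.mul_le_mul_right _ ?_
  calc _ ≤ ∏ _i ∈ Finset.range l, Q := Finset.prod_le_prod' fun i _ => Nat.sub_le _ _
    _ = _ := by simp

theorem prod_pow_sub_pow_le' (q Q l : ℕ) :
    ∏ i ∈ Finset.range (l + 2), (Q - q ^ i) ≤ Q ^ l * (Q - q) * (Q - 1) := by
  rw [Finset.prod_range_succ', pow_zero, Finset.prod_range_succ', zero_add, pow_one]
  refine Nat.mul_le_mul_right _ (Nat.mul_le_mul_right _ ?_)
  calc _ ≤ ∏ _i ∈ Finset.range l, Q := Finset.prod_le_prod' fun i _ => Nat.sub_le _ _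
    _ = _ := by simp

/-- The fraction counts the lines of a `c`-dimensional space: this is Möbius inversion on the
subspace lattice cut after its first-order term. -/
theorem one_sub_le_indicator {q : ℕ} (hq : 2 ≤ q) (c : ℕ) :
    1 - ((q : ℝ) ^ c - 1) / (q - 1) ≤ if c = 0 then 1 else 0 := by
  have hq' : (2 : ℝ) ≤ q := by exact_mod_cast hq
  split_ifs with h
  · simp [h]
  · rw [sub_nonpos, one_le_div (by linarith)]
    have := le_self_pow₀ (show (1 : ℝ) ≤ q by linarith) h
    linarith

/-- The same inversion for `q = 2`, cut after the third-order term. With `x = 2 ^ c` the left side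
equals `-(x - 2) * (x - 4) * (x - 8) / 21`, which is `1` at `c = 0`, `0` for `c = 1, 2, 3` and
negative afterwards. -/
theorem two_bonferroni_le_indicator (c : ℕ) :
    1 - ((2 : ℝ) ^ c - 1) + ((2 : ℝ) ^ c - 1) * ((2 : ℝ) ^ c - 2) / 3
      - ((2 : ℝ) ^ c - 1) * ((2 : ℝ) ^ c - 2) * ((2 : ℝ) ^ c - 4) / 21 ≤
      if c = 0 then 1 else 0 := by
  rcases c with _ | _ | _ | c
  · norm_num
  · norm_num
  · norm_num
  · have hx : (8 : ℝ) ≤ 2 ^ (c + 3) := by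
      rw [pow_add]
      linarith [one_le_pow₀ (show (1 : ℝ) ≤ 2 by norm_num) (n := c)]
    rw [if_neg (by omega)]
    set x : ℝ := 2 ^ (c + 1 + 1 + 1) with hxdef
    have h1 : 0 ≤ (x - 2) * (x - 4) * (x - 8) :=
      mul_nonneg (mul_nonneg (by linarith) (by linarith)) (by linarith)
    nlinarith [h1]

end Numerics

/-! ### Comparison of codeword counts for a fixed left kernel -/

section Comparison

variable {F : Type*} [Field F] [Fintype F] {a b : ℕ}

open Classical in
/-- Among the codewords of an MRD code, those whose difference with a given codeword has a given
left kernel are more than `1 / H_q` times as many as in any other code. -/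
theorem RankSeparated.card_filter_leftKer_lt {C M : Finset (Matrix (Fin a) (Fin b) F)}
    {d k w : ℕ} (hC : RankSeparated C d) (hM : RankSeparated M d) (hk : k + d = a + 1)
    (hd : 1 ≤ d) (hcard : M.card = Fintype.card F ^ (b * k)) (X : Matrix (Fin a) (Fin b) F)
    {Y : Matrix (Fin a) (Fin b) F} (hY : Y ∈ M) (hdw : d ≤ w) (hwb : w ≤ b)
    (hcase : 2 < Fintype.card F ∨ w < b ∨ w ≠ d + 1)
    {K : Submodule F (Fin a → F)} (hK : Module.finrank F K + w = a) :
    ((C.filter fun D => leftKer (D - X) = K).card : ℝ) <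
      scalarH (Fintype.card F) * (M.filter fun D => leftKer (D - Y) = K).card := by
  obtain ⟨K', hK'⟩ := Submodule.exists_isCompl K
  have hdim : Module.finrank F K' = w := by
    have h := Submodule.finrank_add_eq_of_isCompl hK'
    rw [Module.finrank_fin_fun] at h
    omega
  obtain ⟨l, rfl⟩ : ∃ l, w = l + d := ⟨w - d, by omega⟩
  have hq : 2 ≤ Fintype.card F := Fintype.one_lt_card
  set q := Fintype.card F with hqdef
  have hqR : (2 : ℝ) ≤ q := by exact_mod_cast hq
  have hub := hC.card_filter_leftKer_eq_le hd hdw X hK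
  rw [show l + d - d + 1 = l + 1 by omega] at hub
  set S := M.filter (fun D => K ≤ leftKer (D - Y) ∧ D ≠ Y) with hS
  let c : Matrix (Fin a) (Fin b) F → ℕ := fun D =>
    Module.finrank F (leftKer (D - Y) ⊓ K' : Submodule F (Fin a → F))
  have hf : ((M.filter fun D => leftKer (D - Y) = K).card : ℝ) =
      ∑ D ∈ S, if c D = 0 then (1 : ℝ) else 0 := by
    rw [Finset.sum_boole, hS, Finset.filter_filter]
    congr 2
    ext D
    simp only [Finset.mem_filter]
    refine and_congr_right fun hD => ⟨fun h => ⟨⟨h.ge, ?_⟩, ?_⟩, fun h => ?_⟩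
    · rintro rfl
      have h1 := rank_add_finrank_leftKer (D - D)
      rw [h, sub_self, Matrix.rank_zero] at h1
      omega
    · exact (leftKer_eq_iff_finrank_inf_eq_zero hK' h.ge).2 h
    · exact (leftKer_eq_iff_finrank_inf_eq_zero hK' h.1.1).1 h.2
  -- These moments of `c D` over `S` are exactly what is needed to sum the pointwise bounds on the
  -- indicator of `c D = 0`.
  have hsum : ∀ j e : ℕ, j + e = l + 1 →
      ∑ D ∈ S, ∏ i ∈ Finset.range j, ((q : ℝ) ^ c D - (q : ℝ) ^ i) =
      (∏ i ∈ Finset.range j, ((q : ℝ) ^ (l + d) - (q : ℝ) ^ i)) * (((q : ℝ) ^ b) ^ e - 1) := by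
    intro j e hje
    have h := hM.sum_prod_leftKer_inf hk hd hcard hY hK' (j := j) (c := e) (by omega)
    have h' := congrArg (Nat.cast : ℕ → ℝ) h
    rw [Nat.cast_sum, Nat.cast_mul, hdim, cast_prod_pow_sub_pow (by omega),
      Nat.cast_sub (Nat.one_le_pow _ _ (by omega))] at h'
    rw [← pow_mul]
    push_cast at h'
    rw [← h']
    refine Finset.sum_congr rfl fun D _ => ?_
    rw [← cast_prod_pow_sub_pow (by omega)]
    push_cast
    rfl
  have hQq : (q : ℝ) ≤ (q : ℝ) ^ b := le_self_pow₀ (by linarith) (by omega)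
  have hS0 : (S.card : ℝ) = ((q : ℝ) ^ b) ^ (l + 1) - 1 := by
    simpa using hsum 0 (l + 1) (by omega)
  have hS1 := hsum 1 l (by omega)
  simp only [Finset.prod_range_one, pow_zero] at hS1
  have hlow1 : ((q : ℝ) ^ b) ^ (l + 1) - 1
      - ((q : ℝ) ^ (l + d) - 1) * (((q : ℝ) ^ b) ^ l - 1) / (q - 1) ≤
      ((M.filter fun D => leftKer (D - Y) = K).card : ℝ) := by
    rw [hf, ← hS0, ← hS1, Finset.sum_div, Finset.card_eq_sum_ones, Nat.cast_sum,
      ← Finset.sum_sub_distrib]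
    refine Finset.sum_le_sum fun D _ => ?_
    rw [Nat.cast_one]
    exact one_sub_le_indicator hq _
  have hub1 : ((C.filter fun D => leftKer (D - X) = K).card : ℝ) ≤
      ((q : ℝ) ^ b) ^ l * ((q : ℝ) ^ b - 1) := by
    have h := hub.trans (prod_pow_sub_pow_le q (q ^ b) l)
    have h' : ((C.filter fun D => leftKer (D - X) = K).card : ℝ) ≤
      ((q ^ b) ^ l * (q ^ b - 1) : ℕ) := by exact_mod_cast h
    rw [Nat.cast_mul, Nat.cast_sub (Nat.one_le_pow _ _ (by omega))] at h'
    push_cast at h'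
    exact h'
  have hP1 : (1 : ℝ) ≤ ((q : ℝ) ^ b) ^ l := one_le_pow₀ (by linarith)
  rcases lt_or_eq_of_le hq with h2 | h2
  · -- the case of a field with more than two elements
    rw [scalarH, if_neg (by omega)]
    have h3 : (3 : ℝ) ≤ q := by exact_mod_cast h2
    have hw : (q : ℝ) ^ (l + d) ≤ (q : ℝ) ^ b := pow_le_pow_right₀ (by linarith) hwb
    rw [div_mul_eq_mul_div, lt_div_iff₀ (by linarith)]
    rw [pow_succ] at hlow1
    generalize (q : ℝ) ^ b = Q at *
    generalize Q ^ l = P at *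
    generalize (q : ℝ) ^ (l + d) = A at *
    generalize ((M.filter fun D => leftKer (D - Y) = K).card : ℝ) = f at *
    generalize ((C.filter fun D => leftKer (D - X) = K).card : ℝ) = g at *
    generalize (q : ℝ) = q' at *
    have h4 : (P * Q - 1) * (q' - 1) - (A - 1) * (P - 1) ≤ f * (q' - 1) := by
      have := mul_le_mul_of_nonneg_right hlow1 (show (0 : ℝ) ≤ q' - 1 by linarith)
      rwa [sub_mul, div_mul_cancel₀ _ (by linarith)] at this
    have h5 : (A - 1) * (P - 1) ≤ (Q - 1) * (P - 1) :=
      mul_le_mul_of_nonneg_right (by linarith) (by linarith)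
    have h6 : g * (q' - 2) ≤ P * (Q - 1) * (q' - 2) :=
      mul_le_mul_of_nonneg_right hub1 (by linarith)
    -- The terms in `P * Q` cancel, leaving a gap of at least `Q - q' + P * (q' - 1)`.
    nlinarith [mul_le_mul_of_nonneg_right hP1 (show (0 : ℝ) ≤ q' - 2 by linarith)]
  · have hq2 : (q : ℝ) = 2 := by exact_mod_cast h2.symm
    rw [scalarH, if_pos h2.symm]
    rcases lt_or_eq_of_le hwb with hlt | heq
    · -- matrices with more columns than the rank
      rw [hq2] at hlow1 hub1 hP1 hQq
      have hw : (2 : ℝ) ^ (l + d) * 2 ≤ (2 : ℝ) ^ b := by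
        rw [← pow_succ]
        exact pow_le_pow_right₀ (by norm_num) hlt
      rw [pow_succ] at hlow1
      generalize (2 : ℝ) ^ b = Q at *
      generalize Q ^ l = P at *
      generalize (2 : ℝ) ^ (l + d) = A at *
      generalize ((M.filter fun D => leftKer (D - Y) = K).card : ℝ) = f at *
      generalize ((C.filter fun D => leftKer (D - X) = K).card : ℝ) = g at *
      -- `w < b` halves the subtracted term, so the first-order bound suffices; even the factor `2`
      -- would do here.
      have h5 : (A - 1) * (P - 1) ≤ (Q / 2 - 1) * (P - 1) :=
        mul_le_mul_of_nonneg_right (by linarith) (by linarith)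
      norm_num at hlow1
      nlinarith
    · rcases Nat.eq_zero_or_pos l with rfl | hl
      · rw [hq2] at hlow1 hub1 hQq
        simp at hlow1 hub1
        linarith
      -- `hcase` excludes `l = 1`. For `q = 2` and `w = b` the leading terms of the first-order
      -- bound cancel, so the third-order bound is needed.
      · obtain ⟨l, rfl⟩ : ∃ l', l = l' + 2 := ⟨l - 2, by omega⟩
        have hS2 := hsum 2 (l + 1) (by omega)
        have hS3 := hsum 3 l (by omega)
        have hub2 : ((C.filter fun D => leftKer (D - X) = K).card : ℝ) ≤
            ((2 : ℝ) ^ b) ^ (l + 1) * ((2 : ℝ) ^ b - 2) * ((2 : ℝ) ^ b - 1) := by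
          have h := hub.trans (prod_pow_sub_pow_le' q (q ^ b) (l + 1))
          have h' : ((C.filter fun D => leftKer (D - X) = K).card : ℝ) ≤
            ((q ^ b) ^ (l + 1) * (q ^ b - q) * (q ^ b - 1) : ℕ) := by exact_mod_cast h
          rw [Nat.cast_mul, Nat.cast_mul, Nat.cast_sub (Nat.one_le_pow _ _ (by omega)),
            Nat.cast_sub (Nat.le_self_pow (by omega) _)] at h'
          push_cast at h'
          rwa [hq2] at h'
        simp only [Finset.prod_range_succ, Finset.prod_range_zero, pow_zero, one_mul, pow_one, hq2,
          heq] at hS1 hS2 hS3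
        rw [hq2] at hS0
        have hlow2 : (((2 : ℝ) ^ b) ^ (l + 2 + 1) - 1)
            - ((2 : ℝ) ^ b - 1) * (((2 : ℝ) ^ b) ^ (l + 2) - 1)
            + ((2 : ℝ) ^ b - 1) * ((2 : ℝ) ^ b - 2) * (((2 : ℝ) ^ b) ^ (l + 1) - 1) / 3
            - ((2 : ℝ) ^ b - 1) * ((2 : ℝ) ^ b - 2) * ((2 : ℝ) ^ b - 2 ^ 2) *
              (((2 : ℝ) ^ b) ^ l - 1) / 21 ≤
            ((M.filter fun D => leftKer (D - Y) = K).card : ℝ) := by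
          rw [hf, ← hS0, ← hS1, ← hS2, ← hS3, Finset.sum_div, Finset.sum_div,
            Finset.card_eq_sum_ones, Nat.cast_sum, ← Finset.sum_sub_distrib,
            ← Finset.sum_add_distrib, ← Finset.sum_sub_distrib]
          refine Finset.sum_le_sum fun D _ => ?_
          have h := two_bonferroni_le_indicator (c D)
          norm_num at h ⊢
          exact h
        have hQ8 : (8 : ℝ) ≤ (2 : ℝ) ^ b := by
          calc (8 : ℝ) = 2 ^ 3 := by norm_num
            _ ≤ 2 ^ b := pow_le_pow_right₀ (by norm_num) (by omega)
        have hR1 : (1 : ℝ) ≤ ((2 : ℝ) ^ b) ^ l := one_le_pow₀ (by linarith)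
        clear hS1 hS2 hS3 hS0 hf hlow1 hub1
        simp only [pow_succ _ l, pow_succ _ (l + 1), pow_succ _ (l + 2)] at hlow2 hub2
        generalize (2 : ℝ) ^ b = Q at *
        generalize Q ^ l = R at *
        generalize ((M.filter fun D => leftKer (D - Y) = K).card : ℝ) = f at *
        generalize ((C.filter fun D => leftKer (D - X) = K).card : ℝ) = g at *
        -- The coefficient `6 / 21` is `1 - 1 + 1 / 3 - 1 / 21 = 2 / 7`, the inverse of `H_2`. Its
        -- term cancels the upper bound `hub2` exactly, which is why `hub2` keeps the factor `Q -
        -- 2`; `R * Q * Q` gives strictness.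
        have h1 : R * Q * Q + Q - 2
            + (Q - 1) * (Q - 2) * (6 * (R * Q) + 4 * R + Q - 11) / 21 ≤ f := by
          refine le_trans (le_of_eq ?_) hlow2
          ring
        have h2 : 0 ≤ (Q - 1) * (Q - 2) * (4 * R + Q - 11) :=
          mul_nonneg (mul_nonneg (by linarith) (by linarith)) (by linarith)
        have h3 : 0 < R * Q * Q := by positivity
        nlinarith

end Comparison

/-! ### Gabidulin codes and the size of MRD codes -/

section Gabidulin

variable {F : Type*} [Field F] [Fintype F]

open Polynomial in
/-- A nonzero linearized polynomial of `q`-degree less than `k` has at most `q ^ (k - 1)` roots. -/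
theorem card_roots_linearized_le {K : Type*} [Field K] {q k : ℕ} (hq : 2 ≤ q) {c : Fin k → K}
    (hc : c ≠ 0) {S : Finset K} (hS : ∀ x ∈ S, ∑ j, c j * x ^ q ^ (j : ℕ) = 0) :
    S.card ≤ q ^ (k - 1) := by
  classical
  set p : K[X] := ∑ j, C (c j) * X ^ q ^ (j : ℕ) with hp
  have hinj : Function.Injective fun j : ℕ => q ^ j := Nat.pow_right_injective hq
  have hp0 : p ≠ 0 := by
    obtain ⟨j, hj⟩ := Function.ne_iff.1 hc
    intro h
    apply hj
    have h1 : p.coeff (q ^ (j : ℕ)) = c j := by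
      simp only [hp, finsetSum_coeff, coeff_C_mul_X_pow]
      rw [Finset.sum_eq_single j]
      · simp
      · intro i _ hij
        rw [if_neg]
        intro h
        exact hij (Fin.ext (hinj h).symm)
      · simp
    rw [← h1, h, coeff_zero, Pi.zero_apply]
  have hdeg : p.natDegree ≤ q ^ (k - 1) := by
    refine natDegree_sum_le_of_forall_le _ _ fun j _ => ?_
    refine (natDegree_C_mul_X_pow_le _ _).trans (Nat.pow_le_pow_right (by omega) ?_)
    have := j.2
    omega
  refine le_trans (card_le_degree_of_subset_roots (p := p) fun x hx => ?_) hdeg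
  rw [mem_roots hp0, IsRoot.def, hp, eval_finsetSum]
  simpa using hS x hx

/-- Gabidulin codes attain the Singleton bound. -/
theorem exists_rankSeparated_card_eq {a b d k : ℕ} (hab : a ≤ b) (hk : k + d = a + 1)
    (hk1 : 1 ≤ k) (hd : 1 ≤ d) :
    ∃ C : Finset (Matrix (Fin a) (Fin b) F),
      RankSeparated C d ∧ C.card = Fintype.card F ^ (b * k) := by
  classical
  obtain ⟨p, hp⟩ := CharP.exists F
  have : Fact p.Prime := ⟨CharP.char_is_prime F p⟩
  have : NeZero b := ⟨by omega⟩
  let K := FiniteField.Extension F p b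
  have hK : Module.finrank F K = b := FiniteField.finrank_extension F p b
  have hKcard : Nat.card K = Fintype.card F ^ b := by
    rw [FiniteField.natCard_extension, Nat.card_eq_fintype_card]
  let _ : Fintype K := Fintype.ofFinite K
  let β := Module.finBasisOfFinrankEq F K hK
  have hq : 2 ≤ Fintype.card F := Fintype.one_lt_card
  let ι : (Fin a → F) →ₗ[F] K := Fintype.linearCombination F (fun i => β (Fin.castLE hab i))
  have hι : Function.Injective ι :=
    LinearIndependent.fintypeLinearCombination_injective
      (β.linearIndependent.comp _ (Fin.castLE_injective hab))
  let φ : ℕ → K →ₗ[F] K := fun j => (FiniteField.frobeniusAlgHom F K).toLinearMap ^ j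
  have hφ : ∀ j x, φ j x = x ^ Fintype.card F ^ j := by
    intro j
    induction j with
    | zero => intro x; simp [φ]
    | succ j ih =>
      intro x
      have : φ (j + 1) x = φ j (φ 1 x) := by simp [φ, pow_succ]
      rw [this, ih]
      simp [φ, ← pow_mul, pow_succ, mul_comm]
  -- The rows are the coordinates of the linearized polynomial with coefficients `c` at `a`
  -- independent points, so `ι` maps the left kernel into its roots.
  let Φ : (Fin k → K) → Matrix (Fin a) (Fin b) F := fun c =>
    Matrix.of fun i => β.equivFun (∑ j, c j * φ j (ι (Pi.single i 1)))
  have hΦ : ∀ c x, Matrix.vecMul x (Φ c) = β.equivFun (∑ j, c j * ι x ^ Fintype.card F ^ (j : ℕ)) := by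
    intro c x
    have hx : ∀ j, φ j (ι x) = ∑ i, x i • φ j (ι (Pi.single i 1)) := by
      intro j
      conv_lhs => rw [pi_eq_sum_univ' x]
      simp only [map_sum, map_smul]
    have hsum : ∑ j : Fin k, c j * ι x ^ Fintype.card F ^ (j : ℕ) =
        ∑ j : Fin k, ∑ i, x i • (c j * φ j (ι (Pi.single i 1))) := by
      refine Finset.sum_congr rfl fun j _ => ?_
      rw [← hφ, hx, Finset.mul_sum]
      simp only [mul_smul_comm]
    rw [hsum, Finset.sum_comm, map_sum, Matrix.vecMul_eq_sum]
    refine Finset.sum_congr rfl fun i _ => ?_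
    rw [← Finset.smul_sum, map_smul]
    rfl
  have hsub : ∀ c c', Φ (c - c') = Φ c - Φ c' := by
    intro c c'
    ext1 i j
    simp [Φ, sub_mul]
  have hrank : ∀ c, c ≠ 0 → d ≤ (Φ c).rank := by
    intro c hc
    have h1 := rank_add_finrank_leftKer (Φ c)
    have h2 : Fintype.card F ^ Module.finrank F (leftKer (Φ c)) ≤ Fintype.card F ^ (k - 1) := by
      let S : Finset K := Finset.univ.filter fun y => ∃ x ∈ leftKer (Φ c), ι x = y
      refine le_trans ?_ (card_roots_linearized_le hq hc (S := S) ?_)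
      · rw [← Nat.card_eq_fintype_card, ← Module.natCard_eq_pow_finrank, ← Nat.card_eq_finsetCard]
        refine Nat.card_le_card_of_injective (fun x => ⟨ι x, ?_⟩) ?_
        · simp only [S, Finset.mem_filter, Finset.mem_univ, true_and]
          exact ⟨x, x.2, rfl⟩
        · intro x y h
          exact Subtype.ext (hι (congrArg Subtype.val h))
      · intro y hy
        obtain ⟨x, hx, rfl⟩ := (Finset.mem_filter.1 hy).2
        rw [mem_leftKer, hΦ] at hx
        exact (LinearEquiv.map_eq_zero_iff _).1 hx
    have h3 := (Nat.pow_le_pow_iff_right hq).1 h2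
    omega
  have hinj : Function.Injective Φ := by
    intro c c' h
    by_contra hne
    have h1 := hrank (c - c') (sub_ne_zero.2 hne)
    rw [hsub, h, sub_self, Matrix.rank_zero] at h1
    omega
  refine ⟨Finset.univ.image Φ, ?_, ?_⟩
  · intro X hX Y hY hne
    obtain ⟨c, -, rfl⟩ := Finset.mem_image.1 hX
    obtain ⟨c', -, rfl⟩ := Finset.mem_image.1 hY
    rw [← hsub]
    refine hrank _ (sub_ne_zero.2 ?_)
    rintro rfl
    exact hne rfl
  · rw [Finset.card_image_of_injective _ hinj, Finset.card_univ, Fintype.card_fun, Fintype.card_fin,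
      ← Nat.card_eq_fintype_card (α := K), hKcard, ← pow_mul]

/-- A code attaining the Singleton bound for the separation `d` has minimum rank distance `d`. -/
theorem RankSeparated.hasMinRankDist {a b d k : ℕ} {C : Finset (Matrix (Fin a) (Fin b) F)}
    (hC : RankSeparated C d) (hb : 1 ≤ b) (hk : k + d = a + 1) (hk1 : 1 ≤ k) (hd : 1 ≤ d)
    (hcard : C.card = Fintype.card F ^ (b * k)) :
    HasMinRankDist (C : Set (Matrix (Fin a) (Fin b) F)) d := by
  have hq : 2 ≤ Fintype.card F := Fintype.one_lt_card
  refine ⟨?_, ?_⟩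
  · by_contra hcon
    -- If `d` were not attained, the Singleton bound for `d + 1` would be violated. The exact value
    -- matters because `IsMRD` compares only codes with minimum distance exactly `d`.
    have h1 : RankSeparated C (d + 1) := by
      intro X hX Y hY hne
      refine lt_of_le_of_ne (hC X hX Y hY hne) fun h => hcon ⟨X, hX, Y, hY, hne, h.symm⟩
    have h2 := h1.card_le (c := k - 1) (by omega) (by omega)
    rw [hcard] at h2
    have h3 := Nat.le_of_mul_le_mul_left ((Nat.pow_le_pow_iff_right hq).1 h2) (by omega)
    omega
  · rintro _ ⟨X, hX, Y, hY, hne, rfl⟩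
    exact hC X hX Y hY hne

theorem IsMRD.card_eq {a b d k : ℕ} {M : Finset (Matrix (Fin a) (Fin b) F)} (hab : a ≤ b)
    (hM : IsMRD (M : Set (Matrix (Fin a) (Fin b) F)) d) (hk : k + d = a + 1) :
    M.card = Fintype.card F ^ (b * k) := by
  obtain ⟨hd, hda⟩ := hM.1.one_le_and_le
  obtain ⟨G, hG, hGcard⟩ := exists_rankSeparated_card_eq (F := F) hab hk (by omega) hd
  refine le_antisymm (hM.1.rankSeparated.card_le hk hd) ?_
  have h := hM.2 G (hG.hasMinRankDist (by omega) hk (by omega) hd hGcard)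
  rwa [Set.ncard_coe_finset, Set.ncard_coe_finset, hGcard] at h

end Gabidulin

open Module (finrank)

/-! ### Classification of pairs of subspaces -/

section Equivalences

theorem exists_disjoint_inf_sup_eq {α : Type*} [Lattice α] [BoundedOrder α] [IsModularLattice α]
    [ComplementedLattice α] (U V : α) : ∃ P ≤ V, Disjoint U P ∧ (U ⊓ V) ⊔ P = V := by
  obtain ⟨P, hP, hsup⟩ := IsModularLattice.exists_disjoint_and_sup_eq (inf_le_right : U ⊓ V ≤ V)
  have hPV : P ≤ V := le_sup_right.trans hsup.le
  refine ⟨P, hPV, ?_, hsup⟩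
  rw [disjoint_iff, ← inf_eq_right.2 hPV, ← inf_assoc]
  exact hP.eq_bot

variable {F V V' : Type*} [Field F] [AddCommGroup V] [Module F V] [AddCommGroup V'] [Module F V']

/-- Gluing linear equivalences between complementary subspaces. -/
theorem exists_linearEquiv_of_isCompl {A B : Submodule F V} {A' B' : Submodule F V'}
    (h : IsCompl A B) (h' : IsCompl A' B') (f : A ≃ₗ[F] A') (g : B ≃ₗ[F] B') :
    ∃ e : V ≃ₗ[F] V', (∀ x : A, e x = f x) ∧ ∀ x : B, e x = g x := by
  refine ⟨(A.prodEquivOfIsCompl B h).symm ≪≫ₗ f.prodCongr g ≪≫ₗ A'.prodEquivOfIsCompl B' h',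
    fun x => ?_, fun x => ?_⟩ <;> simp

theorem map_eq_of_forall_apply_eq {A : Submodule F V} {A' : Submodule F V'} (e : V ≃ₗ[F] V')
    (f : A ≃ₗ[F] A') (h : ∀ x : A, e x = f x) : A.map e.toLinearMap = A' := by
  ext y
  constructor
  · rintro ⟨x, hx, rfl⟩
    exact (h ⟨x, hx⟩).symm ▸ (f ⟨x, hx⟩).2
  · intro hy
    refine ⟨f.symm ⟨y, hy⟩, (f.symm ⟨y, hy⟩).2, ?_⟩
    simp [h]

variable [FiniteDimensional F V] [FiniteDimensional F V']

theorem exists_linearEquiv_map_eq {A : Submodule F V} {A' : Submodule F V'}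
    (hV : finrank F V = finrank F V') (hA : finrank F A = finrank F A') :
    ∃ e : V ≃ₗ[F] V', A.map e.toLinearMap = A' := by
  obtain ⟨B, hB⟩ := A.exists_isCompl
  obtain ⟨B', hB'⟩ := A'.exists_isCompl
  have h1 := Submodule.finrank_add_eq_of_isCompl hB
  have h2 := Submodule.finrank_add_eq_of_isCompl hB'
  obtain ⟨e, he, -⟩ := exists_linearEquiv_of_isCompl hB hB' (LinearEquiv.ofFinrankEq A A' hA)
    (LinearEquiv.ofFinrankEq B B' (by omega))
  exact ⟨e, map_eq_of_forall_apply_eq e _ he⟩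

/-- Like `exists_linearEquiv_map_eq`, for subspaces given in ambient spaces. -/
theorem exists_linearEquiv_submodule {A B : Submodule F V} {A' B' : Submodule F V'}
    (hAB : A ≤ B) (hAB' : A' ≤ B') (hB : finrank F B = finrank F B')
    (hA : finrank F A = finrank F A') :
    ∃ f : B ≃ₗ[F] B', ∀ e : V ≃ₗ[F] V', (∀ x : B, e x = f x) → A.map e.toLinearMap = A' := by
  have h1 : finrank F (A.comap B.subtype) = finrank F A :=
    (Submodule.comapSubtypeEquivOfLe hAB).finrank_eq
  have h2 : finrank F (A'.comap B'.subtype) = finrank F A' :=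
    (Submodule.comapSubtypeEquivOfLe hAB').finrank_eq
  obtain ⟨f, hf⟩ := exists_linearEquiv_map_eq (A := A.comap B.subtype) (A' := A'.comap B'.subtype)
    hB (by omega)
  refine ⟨f, fun e he => ?_⟩
  ext y
  constructor
  · rintro ⟨x, hx, rfl⟩
    have h3 : f ⟨x, hAB hx⟩ ∈ A'.comap B'.subtype := hf ▸ ⟨⟨x, hAB hx⟩, hx, rfl⟩
    have h4 : (f ⟨x, hAB hx⟩ : V') ∈ A' := h3
    rw [← he] at h4
    exact h4
  · intro hy
    have h3 : (⟨y, hAB' hy⟩ : B') ∈ A'.comap B'.subtype := hy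
    rw [← hf] at h3
    obtain ⟨x, hx, hxy⟩ := h3
    refine ⟨x, hx, (he x).trans ?_⟩
    exact congrArg Subtype.val hxy

/-- The part `P` of `U₁` outside `U` is disjoint from `U` and so extends to a complement `B`; an
equivalence can then be prescribed independently on `U` and on `B`. -/
theorem exists_isCompl_of_inf (U U₁ : Submodule F V) :
    ∃ P B : Submodule F V, IsCompl U B ∧ P ≤ B ∧ (U ⊓ U₁) ⊔ P = U₁ ∧
      finrank F (U ⊓ U₁ : Submodule F V) + finrank F P = finrank F U₁ := by
  obtain ⟨P, -, hUP, hsup⟩ := exists_disjoint_inf_sup_eq U U₁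
  obtain ⟨B, hPB, hB⟩ := hUP.symm.exists_isCompl
  refine ⟨P, B, hB.symm, hPB, hsup, ?_⟩
  rw [← finrank_sup_of_disjoint (hUP.mono_left inf_le_left), hsup]

/-- Pairs of subspaces are classified up to linear equivalence by the dimensions. -/
theorem exists_linearEquiv_map_pair_eq {U U₁ : Submodule F V} {W W₁ : Submodule F V'}
    (hV : finrank F V = finrank F V') (hU : finrank F U = finrank F W)
    (hU₁ : finrank F U₁ = finrank F W₁)
    (hI : finrank F (U ⊓ U₁ : Submodule F V) = finrank F (W ⊓ W₁ : Submodule F V')) :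
    ∃ e : V ≃ₗ[F] V', U.map e.toLinearMap = W ∧ U₁.map e.toLinearMap = W₁ := by
  obtain ⟨P, B, hB, hPB, hsup, hdim⟩ := exists_isCompl_of_inf U U₁
  obtain ⟨P', B', hB', hPB', hsup', hdim'⟩ := exists_isCompl_of_inf W W₁
  have h1 := Submodule.finrank_add_eq_of_isCompl hB
  have h2 := Submodule.finrank_add_eq_of_isCompl hB'
  obtain ⟨f, hf⟩ := exists_linearEquiv_submodule (inf_le_left : U ⊓ U₁ ≤ U)
    (inf_le_left : W ⊓ W₁ ≤ W) hU hI
  obtain ⟨g, hg⟩ := exists_linearEquiv_submodule hPB hPB' (by omega) (by omega)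
  obtain ⟨e, hef, heg⟩ := exists_linearEquiv_of_isCompl hB hB' f g
  refine ⟨e, map_eq_of_forall_apply_eq e f hef, ?_⟩
  rw [← hsup, Submodule.map_sup, hf e hef, hg e heg, hsup']

end Equivalences

/-! ### Subspace distance and liftings -/

section Distance

variable {F κ : Type*} [Field F]

theorem subspaceDist_comm (U V : Submodule F (κ → F)) : subspaceDist U V = subspaceDist V U := by
  rw [subspaceDist, subspaceDist, sup_comm, inf_comm]

theorem subspaceDist_map (e : (κ → F) ≃ₗ[F] (κ → F)) (U V : Submodule F (κ → F)) :
    subspaceDist (U.map e.toLinearMap) (V.map e.toLinearMap) = subspaceDist U V := by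
  rw [subspaceDist, ← Submodule.map_sup, ← Submodule.map_inf _ e.injective]
  simp only [subspaceDist, LinearEquiv.finrank_map_eq]

variable [Fintype κ]

theorem subspaceDist_add (U V : Submodule F (κ → F)) :
    subspaceDist U V + 2 * finrank F (U ⊓ V : Submodule F (κ → F)) = finrank F U + finrank F V := by
  have h := Submodule.finrank_sup_add_finrank_inf_eq U V
  have h1 : finrank F (U ⊓ V : Submodule F (κ → F)) ≤
    finrank F (U ⊔ V : Submodule F (κ → F)) := Submodule.finrank_mono (inf_le_left.trans le_sup_left)
  rw [subspaceDist]
  omega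

theorem subspaceDist_triangle (U V W : Submodule F (κ → F)) :
    subspaceDist U W ≤ subspaceDist U V + subspaceDist V W := by
  have h1 := subspaceDist_add U V
  have h2 := subspaceDist_add V W
  have h3 := subspaceDist_add U W
  have h4 := Submodule.finrank_sup_add_finrank_inf_eq (U ⊓ V) (V ⊓ W)
  have h5 : finrank F ((U ⊓ V) ⊔ (V ⊓ W) : Submodule F (κ → F)) ≤ finrank F V :=
    Submodule.finrank_mono (sup_le inf_le_right inf_le_left)
  have h6 : finrank F ((U ⊓ V) ⊓ (V ⊓ W) : Submodule F (κ → F)) ≤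
      finrank F (U ⊓ W : Submodule F (κ → F)) :=
    Submodule.finrank_mono (inf_le_inf inf_le_left inf_le_right)
  omega

theorem mem_lifting {a b : ℕ} {C : Matrix (Fin a) (Fin b) F} {z : Fin a ⊕ Fin b → F} :
    z ∈ lifting C ↔ ∀ j, z (Sum.inr j) = Matrix.vecMul (z ∘ Sum.inl) C j := by
  rw [lifting, rowSpace, Submodule.mem_span_range_iff_exists_fun]
  have h : ∀ c : Fin a → F, ∑ i, c i • (Matrix.fromCols (1 : Matrix (Fin a) (Fin a) F) C).row i =
      Sum.elim c (Matrix.vecMul c C) := by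
    intro c
    have h1 := Matrix.vecMul_fromCols (1 : Matrix (Fin a) (Fin a) F) C c
    rw [Matrix.vecMul_one] at h1
    rw [← h1, Matrix.vecMul_eq_sum]
    rfl
  simp only [h]
  constructor
  · rintro ⟨c, rfl⟩ j
    simp
  · intro hz
    refine ⟨z ∘ Sum.inl, ?_⟩
    ext (i | j)
    · rfl
    · exact (hz j).symm

/-- The lifting of a matrix is the graph of its action on row vectors. -/
noncomputable def liftingMap {a b : ℕ} (C : Matrix (Fin a) (Fin b) F) :
    (Fin a → F) →ₗ[F] (Fin a ⊕ Fin b → F) :=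
  (LinearEquiv.sumArrowLequivProdArrow (Fin a) (Fin b) F F).symm.toLinearMap ∘ₗ
    LinearMap.prod LinearMap.id C.vecMulLinear

theorem liftingMap_apply {a b : ℕ} (C : Matrix (Fin a) (Fin b) F) (x : Fin a → F) :
    liftingMap C x = Sum.elim x (Matrix.vecMul x C) := by
  ext (i | j) <;> simp [liftingMap]

theorem liftingMap_injective {a b : ℕ} (C : Matrix (Fin a) (Fin b) F) :
    Function.Injective (liftingMap C) := by
  intro x y h
  ext i
  simpa [liftingMap_apply] using congrFun h (Sum.inl i)

theorem finrank_lifting_inf {a b : ℕ} (X Y : Matrix (Fin a) (Fin b) F) :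
    finrank F (lifting X ⊓ lifting Y : Submodule F (Fin a ⊕ Fin b → F)) =
      finrank F (leftKer (X - Y)) := by
  rw [(Submodule.equivMapOfInjective _ (liftingMap_injective X) (leftKer (X - Y))).finrank_eq]
  suffices h : lifting X ⊓ lifting Y = (leftKer (X - Y)).map (liftingMap X) by rw [h]
  ext z
  rw [Submodule.mem_inf, mem_lifting, mem_lifting]
  constructor
  · rintro ⟨hX, hY⟩
    refine ⟨z ∘ Sum.inl, mem_leftKer_sub.2 (funext fun j => (hX j).symm.trans (hY j)), ?_⟩
    rw [liftingMap_apply]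
    ext (i | j)
    · rfl
    · exact (hX j).symm
  · rintro ⟨x, hx, rfl⟩
    rw [liftingMap_apply]
    exact ⟨fun j => by simp, fun j => by simpa using congrFun (mem_leftKer_sub.1 hx) j⟩

theorem finrank_lifting {a b : ℕ} (X : Matrix (Fin a) (Fin b) F) : finrank F (lifting X) = a := by
  have h := finrank_lifting_inf X X
  have h1 := rank_add_finrank_leftKer (X - X)
  rw [inf_idem] at h
  rw [sub_self, Matrix.rank_zero] at h1
  rw [h, sub_self]
  omega

theorem subspaceDist_lifting {a b : ℕ} (X Y : Matrix (Fin a) (Fin b) F) :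
    subspaceDist (lifting X) (lifting Y) = 2 * (X - Y).rank := by
  have h := subspaceDist_add (lifting X) (lifting Y)
  have h1 := rank_add_finrank_leftKer (X - Y)
  rw [finrank_lifting_inf, finrank_lifting, finrank_lifting] at h
  omega

/-- A received subspace beyond the decoding radius is decodable to some other subspace. -/
theorem exists_subspace_near {r d u v : ℕ} (hr : 2 * r ≤ Fintype.card κ) (hd : 1 ≤ d) (hdr : d ≤ r)
    (hu : d + 1 ≤ u) (hv : |(v : ℤ) - (r : ℤ)| ≤ (d : ℤ) - 1) {U V : Submodule F (κ → F)}
    (hU : finrank F U = r) (hV : V ∈ receivedEvent U u v) :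
    ∃ U' : Submodule F (κ → F), finrank F U' = r ∧
      finrank F (U ⊓ U' : Submodule F (κ → F)) + d ≤ r ∧ subspaceDist V U' ≤ d - 1 := by
  obtain ⟨hVv, hVu⟩ := hV
  have hdist := subspaceDist_add U V
  rw [hVu, hVv, hU] at hdist
  rw [abs_le] at hv
  obtain ⟨N, hNV, hUN, hsup⟩ := exists_disjoint_inf_sup_eq U V
  have hNdim := finrank_sup_of_disjoint (hUN.mono_left (inf_le_left : U ⊓ V ≤ U))
  rw [hsup, hVv] at hNdim
  -- The least intersection with `V` that puts an `r`-dimensional subspace within `d - 1` of `V`,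
  -- rounded up.
  set t := (r + v - (d - 1) + 1) / 2 with ht
  obtain ⟨A, hAV, hAt, hAU⟩ : ∃ A ≤ V, finrank F A = t ∧
      finrank F (A ⊓ U : Submodule F (κ → F)) + d ≤ r := by
    rcases le_total t (finrank F N) with h | h
    · obtain ⟨A, -, hAN, hA⟩ := exists_between_finrank_eq (bot_le : ⊥ ≤ N) (k := t) (by simp) h
      refine ⟨A, hAN.trans hNV, hA, ?_⟩
      rw [(hUN.mono_right hAN).symm.eq_bot, finrank_bot]
      omega
    · obtain ⟨A, hNA, hAV, hA⟩ := exists_between_finrank_eq hNV (k := t) h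
        (by omega)
      refine ⟨A, hAV, hA, ?_⟩
      have h1 : Disjoint (A ⊓ U) N := hUN.mono_left inf_le_right
      have h2 := finrank_sup_of_disjoint h1
      have h3 : finrank F (A ⊓ U ⊔ N : Submodule F (κ → F)) ≤ finrank F A :=
        Submodule.finrank_mono (sup_le inf_le_left hNA)
      omega
  obtain ⟨R, hR⟩ := (U ⊔ A).exists_isCompl
  have hRdim := Submodule.finrank_add_eq_of_isCompl hR
  have hUA := Submodule.finrank_sup_add_finrank_inf_eq U A
  rw [Module.finrank_fintype_fun_eq_card] at hRdim
  -- `A` is padded to dimension `r` by directions outside `U ⊔ A`, which add nothing to the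
  -- intersection with `U`; `2 * r ≤ Fintype.card κ` leaves room.
  obtain ⟨R₀, -, hR₀R, hR₀⟩ := exists_between_finrank_eq (bot_le : ⊥ ≤ R) (k := r - t) (by simp)
    (by omega)
  have hdisj : Disjoint (U ⊔ A) R₀ := hR.disjoint.mono_right hR₀R
  have hinf : (A ⊔ R₀) ⊓ (U ⊔ A) = A := by
    rw [sup_inf_assoc_of_le R₀ le_sup_right, hdisj.symm.eq_bot, sup_bot_eq]
  refine ⟨A ⊔ R₀, ?_, ?_, ?_⟩
  · rw [finrank_sup_of_disjoint (hdisj.mono_left le_sup_right)]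
    omega
  · refine le_trans (Nat.add_le_add_right (Submodule.finrank_mono ?_) d) hAU
    refine le_inf ?_ inf_le_left
    exact (le_inf inf_le_right (inf_le_left.trans le_sup_left)).trans hinf.le
  · have h1 := subspaceDist_add V (A ⊔ R₀)
    have h2 : finrank F A ≤ finrank F (V ⊓ (A ⊔ R₀) : Submodule F (κ → F)) :=
      Submodule.finrank_mono (le_inf hAV le_sup_left)
    rw [finrank_sup_of_disjoint (hdisj.mono_left le_sup_right)] at h1
    omega

end Distance

/-! ### Conditional probabilities over symmetric channels -/

section Channel

variable {F κ : Type*} [Field F] [Finite F] [Finite κ]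

theorem OperatorChannel.IsSymmetric.exists_toOuterMeasure_eq {W : OperatorChannel F κ}
    (hW : W.IsSymmetric) (U : Submodule F (κ → F)) (u v : ℕ) :
    ∃ p : ENNReal, p ≠ ⊤ ∧ ∀ S ⊆ receivedEvent U u v,
      (W U).toOuterMeasure S = S.ncard * p := by
  rcases (receivedEvent U u v).eq_empty_or_nonempty with h | ⟨V₀, hV₀⟩
  · refine ⟨0, ENNReal.zero_ne_top, fun S hS => ?_⟩
    rw [h, Set.subset_empty_iff] at hS
    simp [hS]
  · refine ⟨W U V₀, (W U).apply_ne_top V₀, fun S hS => ?_⟩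
    have hfin : S.Finite := Set.toFinite S
    obtain ⟨T, rfl⟩ := hfin.exists_finset_coe
    rw [PMF.toOuterMeasure_apply_finset, Set.ncard_coe_finset, ← nsmul_eq_mul]
    refine Finset.sum_eq_card_nsmul fun V hV => ?_
    have h1 := hS hV
    exact hW U V V₀ (h1.1.trans hV₀.1.symm) (h1.2.trans hV₀.2.symm)

/-- Over a symmetric channel, the conditional decoder error probability is a ratio of counts. -/
theorem OperatorChannel.IsSymmetric.decoderErrorProb_eq {W : OperatorChannel F κ}
    (hW : W.IsSymmetric) (𝒞 : Set (Submodule F (κ → F))) {U : Submodule F (κ → F)} {u v t : ℕ}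
    (h : (W U).toOuterMeasure (receivedEvent U u v) ≠ 0) :
    (receivedEvent U u v).Nonempty ∧ decoderErrorProb W 𝒞 U u v t =
      ((receivedEvent U u v ∩ decoderErrorEvent 𝒞 t U).ncard : ℝ) /
        (receivedEvent U u v).ncard := by
  obtain ⟨p, hp, hS⟩ := hW.exists_toOuterMeasure_eq U u v
  have h1 := hS _ subset_rfl
  rw [h1] at h
  refine ⟨?_, ?_⟩
  · by_contra hne
    rw [Set.not_nonempty_iff_eq_empty] at hne
    simp [hne] at h
  · rw [decoderErrorProb, hS _ Set.inter_subset_left, h1,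
      ENNReal.mul_div_mul_right _ _ (right_ne_zero_of_mul h) hp]
    simp

end Channel

/-! ### Received subspaces near a second subspace -/

section NearSets

variable {F κ : Type*} [Field F]

/-- The received subspaces within distance `t` of `U'`. -/
def nearEvent (U U' : Submodule F (κ → F)) (u v t : ℕ) : Set (Submodule F (κ → F)) :=
  receivedEvent U u v ∩ {V | subspaceDist V U' ≤ t}

theorem nearEvent_self (U : Submodule F (κ → F)) (u v : ℕ) :
    nearEvent U U u v u = receivedEvent U u v :=
  Set.inter_eq_left.2 fun V hV => by
    rw [Set.mem_ofPred_eq, subspaceDist_comm, hV.2]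

variable [Finite F] [Fintype κ]

theorem ncard_nearEvent_le {U U₁ W W₁ : Submodule F (κ → F)} (hU : finrank F U = finrank F W)
    (hU₁ : finrank F U₁ = finrank F W₁)
    (hI : finrank F (U ⊓ U₁ : Submodule F (κ → F)) = finrank F (W ⊓ W₁ : Submodule F (κ → F)))
    (u v t : ℕ) : (nearEvent U U₁ u v t).ncard ≤ (nearEvent W W₁ u v t).ncard := by
  obtain ⟨e, rfl, rfl⟩ := exists_linearEquiv_map_pair_eq rfl hU hU₁ hI
  refine Set.ncard_le_ncard_of_injOn (fun V => V.map e.toLinearMap) ?_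
    (Submodule.map_injective_of_injective e.injective).injOn (Set.toFinite _)
  rintro V ⟨⟨h1, h2⟩, h3⟩
  refine ⟨⟨?_, ?_⟩, ?_⟩
  · rw [LinearEquiv.finrank_map_eq, h1]
  · rw [subspaceDist_map, h2]
  · rw [Set.mem_ofPred_eq, subspaceDist_map]
    exact h3

theorem ncard_nearEvent_eq {U U₁ W W₁ : Submodule F (κ → F)} (hU : finrank F U = finrank F W)
    (hU₁ : finrank F U₁ = finrank F W₁)
    (hI : finrank F (U ⊓ U₁ : Submodule F (κ → F)) = finrank F (W ⊓ W₁ : Submodule F (κ → F)))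
    (u v t : ℕ) : (nearEvent U U₁ u v t).ncard = (nearEvent W W₁ u v t).ncard :=
  le_antisymm (ncard_nearEvent_le hU hU₁ hI u v t)
    (ncard_nearEvent_le hU.symm hU₁.symm hI.symm u v t)

/-- The number of received subspaces near `U'` depends only on the dimension of `U ⊓ U'`. -/
theorem exists_ncard_nearEvent_eq (F κ : Type*) [Field F] [Finite F] [Fintype κ] (r u v t : ℕ) :
    ∃ ψ : ℕ → ℕ, ∀ U U' : Submodule F (κ → F), finrank F U = r → finrank F U' = r →
      (nearEvent U U' u v t).ncard = ψ (finrank F (U ⊓ U' : Submodule F (κ → F))) := by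
  classical
  -- Any representative pair defines `ψ`, by invariance under linear equivalence; dimensions that do
  -- not occur get the irrelevant value `0`.
  refine ⟨fun k => if h : ∃ p : Submodule F (κ → F) × Submodule F (κ → F), finrank F p.1 = r ∧
    finrank F p.2 = r ∧ finrank F (p.1 ⊓ p.2 : Submodule F (κ → F)) = k then
      (nearEvent h.choose.1 h.choose.2 u v t).ncard else 0, fun U U' hU hU' => ?_⟩
  have h : ∃ p : Submodule F (κ → F) × Submodule F (κ → F), finrank F p.1 = r ∧
    finrank F p.2 = r ∧ finrank F (p.1 ⊓ p.2 : Submodule F (κ → F)) =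
      finrank F (U ⊓ U' : Submodule F (κ → F)) := ⟨(U, U'), hU, hU', rfl⟩
  simp only [dif_pos h]
  obtain ⟨h1, h2, h3⟩ := h.choose_spec
  exact ncard_nearEvent_eq (hU.trans h1.symm) (hU'.trans h2.symm) h3.symm u v t

end NearSets

/-! ### Decoder errors as sums over codewords -/

section Decoder

variable {F : Type*} [Field F] {a b : ℕ}

theorem exists_of_mem_decoderErrorEvent {C : Finset (Matrix (Fin a) (Fin b) F)}
    {X : Matrix (Fin a) (Fin b) F} {t : ℕ} {V : Submodule F (Fin a ⊕ Fin b → F)}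
    (hV : V ∈ decoderErrorEvent (lifting '' (C : Set (Matrix (Fin a) (Fin b) F))) t (lifting X)) :
    ∃ D ∈ C, D ≠ X ∧ subspaceDist V (lifting D) ≤ t := by
  obtain ⟨D, hD, hne⟩ := hV
  rw [boundedDistanceDecoder] at hD
  split_ifs at hD with h
  obtain ⟨⟨D', hD', h1⟩, h2⟩ := h.choose_spec
  rw [Option.some.injEq] at hD
  rw [hD] at h1 h2
  subst h1
  exact ⟨D', hD', fun h => hne (h ▸ rfl), h2⟩

/-- Since `t < u`, the sent subspace is out of reach, so whichever codeword the decoder chooses is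
wrong. -/
theorem mem_decoderErrorEvent_iff {C : Finset (Matrix (Fin a) (Fin b) F)}
    {X : Matrix (Fin a) (Fin b) F} {u v t : ℕ} (ht : t < u)
    {V : Submodule F (Fin a ⊕ Fin b → F)} (hV : V ∈ receivedEvent (lifting X) u v) :
    V ∈ decoderErrorEvent (lifting '' (C : Set (Matrix (Fin a) (Fin b) F))) t (lifting X) ↔
      ∃ D ∈ C, D ≠ X ∧ subspaceDist V (lifting D) ≤ t := by
  refine ⟨exists_of_mem_decoderErrorEvent, ?_⟩
  rintro ⟨D, hD, -, hdist⟩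
  have h : ∃ D ∈ lifting '' (C : Set (Matrix (Fin a) (Fin b) F)), subspaceDist V D ≤ t :=
    ⟨lifting D, ⟨D, hD, rfl⟩, hdist⟩
  refine ⟨h.choose, by rw [boundedDistanceDecoder, dif_pos h], fun heq => ?_⟩
  have h1 := h.choose_spec.2
  rw [heq, subspaceDist_comm, hV.2] at h1
  omega

/-- A wrong codeword within `d - 1` is at distance at least `2 * d` from the sent one, forcing `u ≥
d + 1`; its dimension `a` differs from `v` by at most the distance. -/
theorem receivedEvent_inter_decoderErrorEvent_eq_empty {C : Finset (Matrix (Fin a) (Fin b) F)}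
    {d : ℕ} (hC : RankSeparated C d) (hd : 1 ≤ d) {X : Matrix (Fin a) (Fin b) F} (hX : X ∈ C)
    {u v : ℕ} (huv : ¬ (d + 1 ≤ u ∧ |(v : ℤ) - (a : ℤ)| ≤ (d : ℤ) - 1)) :
    receivedEvent (lifting X) u v ∩
      decoderErrorEvent (lifting '' (C : Set (Matrix (Fin a) (Fin b) F))) (d - 1) (lifting X) =
      ∅ := by
  rw [Set.eq_empty_iff_forall_notMem]
  rintro V ⟨⟨hV1, hV2⟩, hV3⟩
  obtain ⟨D, hD, hne, hdist⟩ := exists_of_mem_decoderErrorEvent hV3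
  have h1 := subspaceDist_triangle (lifting X) V (lifting D)
  rw [subspaceDist_lifting] at h1
  have h2 := hC X hX D hD hne.symm
  have h3 := subspaceDist_add V (lifting D)
  rw [finrank_lifting] at h3
  have h4 : finrank F (V ⊓ lifting D : Submodule F (Fin a ⊕ Fin b → F)) ≤ finrank F V :=
    Submodule.finrank_mono inf_le_left
  have h5 : finrank F (V ⊓ lifting D : Submodule F (Fin a ⊕ Fin b → F)) ≤ finrank F (lifting D) :=
    Submodule.finrank_mono inf_le_right
  rw [finrank_lifting] at h5
  refine huv ⟨by omega, abs_le.2 ⟨by omega, by omega⟩⟩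

theorem leftKer_sub_comm (X Y : Matrix (Fin a) (Fin b) F) : leftKer (X - Y) = leftKer (Y - X) := by
  ext x
  rw [mem_leftKer_sub, mem_leftKer_sub, eq_comm]

theorem RankSeparated.disjoint_nearEvent {C : Finset (Matrix (Fin a) (Fin b) F)} {d : ℕ}
    (hC : RankSeparated C d) (hd : 1 ≤ d) (U : Submodule F (Fin a ⊕ Fin b → F)) (u v : ℕ)
    {D D' : Matrix (Fin a) (Fin b) F} (hD : D ∈ C) (hD' : D' ∈ C) (hne : D ≠ D') :
    Disjoint (nearEvent U (lifting D) u v (d - 1)) (nearEvent U (lifting D') u v (d - 1)) := by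
  rw [Set.disjoint_left]
  rintro V ⟨-, h1⟩ ⟨-, h2⟩
  have h3 := subspaceDist_triangle (lifting D) V (lifting D')
  rw [subspaceDist_lifting, subspaceDist_comm _ V] at h3
  have h4 := hC D hD D' hD' hne
  rw [Set.mem_ofPred_eq] at h1 h2
  omega

open Classical in
/-- The sum over the codewords other than `X` of the numbers of received subspaces near them. -/
theorem RankSeparated.sum_nearEvent {C : Finset (Matrix (Fin a) (Fin b) F)} {d : ℕ}
    (hC : RankSeparated C d) (hd : 1 ≤ d) {X : Matrix (Fin a) (Fin b) F} (hX : X ∈ C)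
    {u v t : ℕ} {ψ : ℕ → ℕ} (hψ : ∀ U U' : Submodule F (Fin a ⊕ Fin b → F), finrank F U = a →
      finrank F U' = a → (nearEvent U U' u v t).ncard =
        ψ (finrank F (U ⊓ U' : Submodule F (Fin a ⊕ Fin b → F))))
    {T : Finset (Submodule F (Fin a → F))} (hT : ∀ K, K ∈ T ↔ finrank F K + d ≤ a) :
    ∑ D ∈ C.erase X, (nearEvent (lifting X) (lifting D) u v t).ncard =
      ∑ K ∈ T, (C.filter fun D => leftKer (D - X) = K).card * ψ (finrank F K) := by
  rw [← Finset.sum_fiberwise_of_maps_to (t := T) (g := fun D => leftKer (D - X))]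
  · refine Finset.sum_congr rfl fun K hK => ?_
    have hfilter : (C.erase X).filter (fun D => leftKer (D - X) = K) =
        C.filter fun D => leftKer (D - X) = K := by
      ext D
      simp only [Finset.mem_filter, Finset.mem_erase]
      refine ⟨fun h => ⟨h.1.2, h.2⟩, fun h => ⟨⟨?_, h.1⟩, h.2⟩⟩
      rintro rfl
      have h1 := rank_add_finrank_leftKer (D - D)
      rw [h.2, sub_self, Matrix.rank_zero] at h1
      have h2 := (hT K).1 hK
      omega
    rw [hfilter, Finset.card_eq_sum_ones, Finset.sum_mul]
    refine Finset.sum_congr rfl fun D hD => ?_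
    rw [hψ _ _ (finrank_lifting X) (finrank_lifting D), finrank_lifting_inf, leftKer_sub_comm,
      (Finset.mem_filter.1 hD).2, one_mul]
  · intro D hD
    have h1 := rank_add_finrank_leftKer (D - X)
    have h2 := hC D (Finset.mem_of_mem_erase hD) X hX (Finset.ne_of_mem_erase hD)
    rw [hT]
    omega

variable [Fintype F]

open Classical in
/-- The number of received subspaces which lead to a decoder error. -/
theorem RankSeparated.ncard_error {C : Finset (Matrix (Fin a) (Fin b) F)} {d : ℕ}
    (hC : RankSeparated C d) (hd : 1 ≤ d) (X : Matrix (Fin a) (Fin b) F) {u v : ℕ}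
    (hu : d + 1 ≤ u) :
    (receivedEvent (lifting X) u v ∩
      decoderErrorEvent (lifting '' (C : Set (Matrix (Fin a) (Fin b) F))) (d - 1)
        (lifting X)).ncard =
      ∑ D ∈ C.erase X, (nearEvent (lifting X) (lifting D) u v (d - 1)).ncard := by
  let N : Matrix (Fin a) (Fin b) F → Finset (Submodule F (Fin a ⊕ Fin b → F)) := fun D =>
    (Set.toFinite (nearEvent (lifting X) (lifting D) u v (d - 1))).toFinset
  have hunion : receivedEvent (lifting X) u v ∩
      decoderErrorEvent (lifting '' (C : Set (Matrix (Fin a) (Fin b) F))) (d - 1) (lifting X) =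
      ((C.erase X).biUnion N : Finset (Submodule F (Fin a ⊕ Fin b → F))) := by
    ext V
    simp only [Finset.coe_biUnion, Set.mem_iUnion, Finset.mem_coe, Finset.mem_erase, N,
      Set.Finite.coe_toFinset, nearEvent, Set.mem_inter_iff, Set.mem_ofPred_eq]
    constructor
    · rintro ⟨h1, h2⟩
      obtain ⟨D, hD, hne, h3⟩ := exists_of_mem_decoderErrorEvent h2
      exact ⟨D, ⟨hne, hD⟩, h1, h3⟩
    · rintro ⟨D, ⟨hne, hD⟩, h1, h3⟩
      exact ⟨h1, (mem_decoderErrorEvent_iff (by omega) h1).2 ⟨D, hD, hne, h3⟩⟩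
  rw [hunion, Set.ncard_coe_finset, Finset.card_biUnion]
  · refine Finset.sum_congr rfl fun D _ => ?_
    rw [Set.ncard_eq_toFinset_card _ (Set.toFinite _)]
  · intro D hD D' hD' hne
    refine Set.Finite.disjoint_toFinset.2 ?_
    exact hC.disjoint_nearEvent hd _ u v (Finset.mem_of_mem_erase hD)
      (Finset.mem_of_mem_erase hD') hne

/-- Comparison of the numbers of decoder errors of a lifted rank metric code and a lifted MRD
code. -/
theorem RankSeparated.ncard_error_lt {C M : Finset (Matrix (Fin a) (Fin b) F)} {d k u v : ℕ}
    (hC : RankSeparated C d) (hM : RankSeparated M d) (hk : k + d = a + 1) (hk1 : 1 ≤ k)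
    (hd : 1 ≤ d) (hab : a ≤ b) (hcard : M.card = Fintype.card F ^ (b * k))
    {X Y : Matrix (Fin a) (Fin b) F} (hX : X ∈ C) (hY : Y ∈ M)
    (hcase : 2 < Fintype.card F ∨ a < b ∨ d ≠ b - 1)
    (hu : d + 1 ≤ u) (hv : |(v : ℤ) - (a : ℤ)| ≤ (d : ℤ) - 1)
    (hne : (receivedEvent (lifting Y) u v).Nonempty) :
    ((receivedEvent (lifting X) u v ∩
      decoderErrorEvent (lifting '' (C : Set (Matrix (Fin a) (Fin b) F))) (d - 1)
        (lifting X)).ncard : ℝ) <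
    scalarH (Fintype.card F) * (receivedEvent (lifting Y) u v ∩
      decoderErrorEvent (lifting '' (M : Set (Matrix (Fin a) (Fin b) F))) (d - 1)
        (lifting Y)).ncard := by
  classical
  obtain ⟨ψ, hψ⟩ := exists_ncard_nearEvent_eq F (Fin a ⊕ Fin b) a u v (d - 1)
  let T : Finset (Submodule F (Fin a → F)) :=
    (Set.toFinite {K : Submodule F (Fin a → F) | finrank F K + d ≤ a}).toFinset
  have hT : ∀ K, K ∈ T ↔ finrank F K + d ≤ a := fun K => Set.Finite.mem_toFinset _
  rw [hC.ncard_error hd X hu, hM.ncard_error hd Y hu, hC.sum_nearEvent hd hX hψ hT,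
    hM.sum_nearEvent hd hY hψ hT]
  push_cast
  rw [Finset.mul_sum]
  have hlt : ∀ K ∈ T, ((C.filter fun D => leftKer (D - X) = K).card : ℝ) <
      scalarH (Fintype.card F) * (M.filter fun D => leftKer (D - Y) = K).card := by
    intro K hK
    have h1 := (hT K).1 hK
    -- As `w ≤ a ≤ b`, the bad case `w = b = d + 1` would force `a = b` and `d = b - 1`, which
    -- `hcase` excludes for `q = 2`.
    exact hC.card_filter_leftKer_lt hM hk hd hcard X hY (w := a - finrank F K) (by omega)
      (by omega) (by omega) (by omega)
  obtain ⟨V, hV⟩ := hne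
  -- `U'` need not be a codeword: it only shows that `ψ` is positive at some dimension at most `a -
  -- d`, where the strict comparison applies.
  obtain ⟨U', hU', hinf, hVU'⟩ := exists_subspace_near (d := d) (by simp; omega) hd (by omega) hu hv
    (finrank_lifting Y) hV
  have hpos : 0 < ψ (finrank F (lifting Y ⊓ U' : Submodule F (Fin a ⊕ Fin b → F))) := by
    rw [← hψ _ _ (finrank_lifting Y) hU', Set.ncard_pos (Set.toFinite _)]
    exact ⟨V, hV, hVU'⟩
  obtain ⟨K, -, -, hK⟩ := exists_between_finrank_eq
    (bot_le : (⊥ : Submodule F (Fin a → F)) ≤ ⊤)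
    (k := finrank F (lifting Y ⊓ U' : Submodule F (Fin a ⊕ Fin b → F))) (by simp)
    (by rw [finrank_top, Module.finrank_fin_fun]; omega)
  refine Finset.sum_lt_sum (fun K hK => ?_) ⟨K, (hT K).2 (by omega), ?_⟩
  · rw [← mul_assoc]
    exact mul_le_mul_of_nonneg_right (hlt K hK).le (Nat.cast_nonneg _)
  · rw [← mul_assoc]
    refine mul_lt_mul_of_pos_right (hlt K ((hT K).2 (by omega))) ?_
    rw [hK]
    exact_mod_cast hpos

end Decoder

/-! ### The comparison of error probabilities -/

/-- The decoder error probability of the lifting of any rank metric code is less than `H_q` times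
that of a lifted MRD code with the same parameters, for all `u`, `v` for which a decoder error is
possible; for all other `u`, `v` both probabilities are zero. -/
theorem corollary3 {F : Type*} [Field F] [Fintype F] (n r d : ℕ) (hr : r ≤ n - r)
    -- any rank metric code with minimum rank distance `d`, and a codeword
    (C : Set (Matrix (Fin r) (Fin (n - r)) F)) (hC : HasMinRankDist C d)
    (X : Matrix (Fin r) (Fin (n - r)) F) (hX : X ∈ C)
    -- any MRD code with the same parameters, and a codeword
    (M : Set (Matrix (Fin r) (Fin (n - r)) F)) (hM : IsMRD M d)
    (Y : Matrix (Fin r) (Fin (n - r)) F) (hY : Y ∈ M)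
    -- the symmetric operator channels over which the liftings are sent
    (W W' : OperatorChannel F (Fin r ⊕ Fin (n - r))) (hW : W.IsSymmetric) (hW' : W'.IsSymmetric)
    (hcase : 2 < Fintype.card F ∨ r < n - r ∨ d ≠ n - r - 1) (u v : ℕ) :
    (d + 1 ≤ u → |(v : ℤ) - (r : ℤ)| ≤ (d : ℤ) - 1 →
      -- the received subspace can have dimension `v` and be at distance `u` from the sent one
      (W (lifting X)).toOuterMeasure (receivedEvent (lifting X) u v) ≠ 0 →
      (W' (lifting Y)).toOuterMeasure (receivedEvent (lifting Y) u v) ≠ 0 →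
      decoderErrorProb W (lifting '' C) (lifting X) u v (d - 1) <
        scalarH (Fintype.card F) *
          decoderErrorProb W' (lifting '' M) (lifting Y) u v (d - 1)) ∧
    (¬ (d + 1 ≤ u ∧ |(v : ℤ) - (r : ℤ)| ≤ (d : ℤ) - 1) →
      decoderErrorProb W (lifting '' C) (lifting X) u v (d - 1) = 0 ∧
      decoderErrorProb W' (lifting '' M) (lifting Y) u v (d - 1) = 0) := by
  lift C to Finset (Matrix (Fin r) (Fin (n - r)) F) using Set.toFinite C
  lift M to Finset (Matrix (Fin r) (Fin (n - r)) F) using Set.toFinite M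
  obtain ⟨hd, hdr⟩ := hC.one_le_and_le
  have hCs := hC.rankSeparated
  have hMs := hM.1.rankSeparated
  refine ⟨fun hu hv hWne hWne' => ?_, fun huv => ⟨?_, ?_⟩⟩
  · obtain ⟨hne, hP⟩ := hW.decoderErrorProb_eq (lifting '' (C : Set _)) (t := d - 1) hWne
    obtain ⟨hne', hP'⟩ := hW'.decoderErrorProb_eq (lifting '' (M : Set _)) (t := d - 1) hWne'
    have hcard : (receivedEvent (lifting X) u v).ncard = (receivedEvent (lifting Y) u v).ncard := by
      -- Viewed as near sets of the pair `(U, U)`, the two conditioning events have equal size by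
      -- the classification of pairs.
      rw [← nearEvent_self, ← nearEvent_self]
      have h : finrank F (lifting X) = finrank F (lifting Y) :=
        (finrank_lifting X).trans (finrank_lifting Y).symm
      exact ncard_nearEvent_eq h h (by rw [inf_idem, inf_idem, h]) u v u
    have hpos : 0 < (receivedEvent (lifting Y) u v).ncard :=
      (Set.ncard_pos (Set.toFinite _)).2 hne'
    rw [hP, hP', hcard, ← mul_div_assoc]
    refine div_lt_div_of_pos_right ?_ (by exact_mod_cast hpos)
    have hk : r + 1 - d + d = r + 1 := by omega
    exact hCs.ncard_error_lt hMs hk (by omega) hd hr (hM.card_eq hr hk) hX hY hcase hu hv hne'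
  · rw [decoderErrorProb, receivedEvent_inter_decoderErrorEvent_eq_empty hCs hd hX huv]
    simp
  · rw [decoderErrorProb, receivedEvent_inter_decoderErrorEvent_eq_empty hMs hd hY huv]
    simp
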